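/- **Setting.** Let $D\ge 0$. All functions below are defined on $\mathbb{R}^D\times[0,1]$; time derivatives at $t=0,1$ are one-sided. * *Target.* Let $\tilde\rho_*(x,t)>0$ be continuously differentiable on $\mathbb{R}^D\times[0,1]$, with $\mathcal Z(t)=\int\tilde\rho_*(x,t)\,dx<\infty$ for every $t\in[0,1]$ and $\int_0^1\!\int|\partial_t\tilde\rho_*(x,t)|\,dx\,dt<\infty$. Put $\rho_*=\tilde\rho_*/\mathcal Z$, let $\mu(x)=\rho_*(x,0)$ be the initial density, and let $S_*=\nabla_x\log\rho_*$ be the score. * *Flow.* Let $v_\theta:\mathbb{R}^D\times[0,1]\to\mathbb{R}^D$ be a velocity field that is continuous, differentiable in $x$, and whose spatial derivative is continuous in $(x,t)$. Assume that for every $x_0\in\mathbb{R}^D$ a trajectory $x(\cdot\,;x_0)$ on $[0,1]$ with $\dot x(t)=v_\theta(x(t),t)$, $x(0)=x_0$, exists. * *Induced density.* Let $\rho_\theta$ be continuously differentiable on $\mathbb{R}^D\times[0,1]$, with $\rho_\theta(\cdot,t)$ a probability density for every $t$, solving $\partial_t\rho_\theta=-\nabla_x\cdot[v_\theta\rho_\theta]$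 with $\rho_\theta(\cdot,0)=\mu$. Define the pointwise residual of the velocity equation $$\varepsilon(x,t)=\nabla_x\cdot v_\theta(x,t)+S_*(x,t)\cdot v_\theta(x,t)+\partial_t\log\tilde\rho_*(x,t)-\mathbb E_{x'\sim\rho_*(\cdot,t)}\big[\partial_t\log\tilde\rho_*(x',t)\big]$$ (the expectation exists for almost every $t$), and the weight $$\tilde w(t;x_0)=\exp\Big(\int_0^t\varepsilon(x(s;x_0),s)\,ds\Big).$$ **Lemma.** 1. For every $x_0\in\mathbb{R}^D$, the function $s\mapsto\varepsilon(x(s;x_0),s)$ is integrable on $[0,1]$, and for every $t\in[0,1]$ both $\rho_*$ and $\rho_\theta$ are positive at $(x(t;x_0),t)$ and $$\log\frac{\rho_*(x(t;x_0),t)}{\rho_\theta(x(t;x_0),t)}=\int_0^t\varepsilon(x(s;x_0),s)\,ds,\qquad\text{i.e.}\qquad \tilde w(t;x_0)=\frac{\rho_*(x(t;x_0),t)}{\rho_\theta(x(t;x_0),t)} .$$ 2. Let $t\in[0,1]$ and suppose that $\rho_\theta$ dominates $\rho_*$ at time $t$, i.e. $\rho_*(x,t)\,dx\ll\rho_\theta(x,t)\,dx$.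 Then for every measurable $F:\mathbb{R}^D\to\mathbb{R}$, $F$ is integrable with respect to $\rho_*(x,t)\,dx$ if and only if $x_0\mapsto\tilde w(t;x_0)F(x(t;x_0))$ is integrable with respect to $\mu(x_0)\,dx_0$, and in that case $$\mathbb E_{x'\sim\rho_*(\cdot,t)}[F(x')]=\mathbb E_{x_0\sim\mu}\big[\tilde w(t;x_0)\,F(x(t;x_0))\big].$$ -/

import Mathlib

open Set MeasureTheory

noncomputable section

/-- The space `ℝ^D` with its Euclidean norm. -/
abbrev Space (D : ℕ) := EuclideanSpace ℝ (Fin D)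

/-- The divergence `∇ · V = ∑ᵢ ∂ᵢ Vᵢ` of a vector field on `ℝ^D`. -/
def divergence {D : ℕ} (V : Space D → Space D) (x : Space D) : ℝ :=
  ∑ i : Fin D, (fderiv ℝ V x (EuclideanSpace.single i 1)) i

/-- The partial derivative `∂ₜ f(x,t)` of a function of `x ∈ ℝ^D` and `t ∈ [0,1]`
(one-sided at the two endpoints). -/
def timeDeriv {D : ℕ} (f : Space D → ℝ → ℝ) (x : Space D) (t : ℝ) : ℝ :=
  derivWithin (fun s => f x s) (Icc 0 1) t

/-- The measure `p(x) dx` with (nonnegative) Lebesgue density `p`. -/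
def densityMeasure {D : ℕ} (p : Space D → ℝ) : Measure (Space D) :=
  volume.withDensity (fun x => ENNReal.ofReal (p x))

/-- `p` is a probability density function on `ℝ^D`. -/
structure IsProbabilityDensity {D : ℕ} (p : Space D → ℝ) : Prop where
  nonneg : ∀ x, 0 ≤ p x
  integrable : Integrable p
  integral_eq_one : ∫ x, p x = 1

/-- The normalization constant `Z(t) = ∫ ρ̃(x,t) dx`. -/
def partitionFunction {D : ℕ} (rhoU : Space D → ℝ → ℝ) (t : ℝ) : ℝ :=
  ∫ x, rhoU x t

/-- The normalized density `ρ_*(x,t) = ρ̃(x,t) / Z(t)`. -/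
def targetDensity {D : ℕ} (rhoU : Space D → ℝ → ℝ) (x : Space D) (t : ℝ) : ℝ :=
  rhoU x t / partitionFunction rhoU t

/-- The score `S_*(x,t) = ∇ₓ log ρ_*(x,t)` of the target density. -/
def targetScore {D : ℕ} (rhoU : Space D → ℝ → ℝ) (x : Space D) (t : ℝ) : Space D :=
  gradient (fun y => Real.log (targetDensity rhoU y t)) x

/-- The centered time derivative
`∂ₜ log ρ̃(x,t) - 𝔼_{x' ∼ ρ_*(·,t)}[∂ₜ log ρ̃(x',t)]`. -/
def centeredLogDeriv {D : ℕ} (rhoU : Space D → ℝ → ℝ) (x : Space D) (t : ℝ) : ℝ :=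
  timeDeriv (fun y s => Real.log (rhoU y s)) x t
    - ∫ y, timeDeriv (fun z s => Real.log (rhoU z s)) y t
        ∂(densityMeasure (fun y => targetDensity rhoU y t))

/-- The pointwise residual `ε(x,t) = ∇ₓ · v + S_* · v + ∂ₜ δ log ρ̃` of the velocity equation. -/
def velocityResidual {D : ℕ} (v : Space D → ℝ → Space D) (rhoU : Space D → ℝ → ℝ)
    (x : Space D) (t : ℝ) : ℝ :=
  divergence (fun y => v y t) x + inner ℝ (targetScore rhoU x t) (v x t)
    + centeredLogDeriv rhoU x t

/-- The unnormalized importance weight `w̃(t;x₀) = exp (∫₀ᵗ ε(x(s;x₀),s) ds)`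
accumulated along the trajectory `X x₀`. -/
def pathWeight {D : ℕ} (v : Space D → ℝ → Space D) (rhoU : Space D → ℝ → ℝ)
    (X : Space D → ℝ → Space D) (t : ℝ) (x₀ : Space D) : ℝ :=
  Real.exp (∫ s in (0 : ℝ)..t, velocityResidual v rhoU (X x₀ s) s)

/-- A time-dependent unnormalized target density on `ℝ^D × [0,1]`: positive, continuously
differentiable, of finite mass at each time, with `∂ₜ ρ̃` integrable on `ℝ^D × [0,1]`. -/
structure IsUnnormalizedPath {D : ℕ} (rhoU : Space D → ℝ → ℝ) : Prop where
  pos : ∀ x, ∀ t ∈ Icc (0 : ℝ) 1, 0 < rhoU x t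
  contDiffOn : ContDiffOn ℝ 1 (fun p : Space D × ℝ => rhoU p.1 p.2) (univ ×ˢ Icc 0 1)
  integrable : ∀ t ∈ Icc (0 : ℝ) 1, Integrable (fun x => rhoU x t)
  integrableOn_timeDeriv :
    IntegrableOn (fun p : Space D × ℝ => timeDeriv rhoU p.1 p.2) (univ ×ˢ Icc 0 1)

/-- A velocity field on `ℝ^D × [0,1]` that is continuous and has a continuous
spatial derivative. -/
structure IsRegularVelocity {D : ℕ} (v : Space D → ℝ → Space D) : Prop where
  continuousOn : ContinuousOn (fun p : Space D × ℝ => v p.1 p.2) (univ ×ˢ Icc 0 1)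
  differentiable : ∀ t ∈ Icc (0 : ℝ) 1, Differentiable ℝ (fun x => v x t)
  continuousOn_fderiv :
    ContinuousOn (fun p : Space D × ℝ => fderiv ℝ (fun y => v y p.2) p.1) (univ ×ˢ Icc 0 1)

/-- `X x₀` is, for each starting point `x₀`, a trajectory of `v` on `[0,1]`:
`ẋ(t) = v(x(t),t)`, `x(0) = x₀`. -/
structure IsTrajectoryFamily {D : ℕ} (v : Space D → ℝ → Space D)
    (X : Space D → ℝ → Space D) : Prop where
  initial : ∀ x₀, X x₀ 0 = x₀
  deriv : ∀ x₀, ∀ t ∈ Icc (0 : ℝ) 1, HasDerivWithinAt (X x₀) (v (X x₀ t) t) (Icc 0 1) t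

/-- `rho` is a density-valued classical solution on `ℝ^D × [0,1]` of the generalized Liouville
equation `∂ₜ ρ = - ∇ₓ · (v ρ)` with initial density `ρ(·,0) = μ`. -/
structure IsLiouvilleDensity {D : ℕ} (v : Space D → ℝ → Space D) (mu : Space D → ℝ)
    (rho : Space D → ℝ → ℝ) : Prop where
  contDiffOn : ContDiffOn ℝ 1 (fun p : Space D × ℝ => rho p.1 p.2) (univ ×ˢ Icc 0 1)
  density : ∀ t ∈ Icc (0 : ℝ) 1, IsProbabilityDensity (fun x => rho x t)
  liouville : ∀ x, ∀ t ∈ Icc (0 : ℝ) 1,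
    timeDeriv rho x t = - divergence (fun y => rho y t • v y t) x
  initial : ∀ x, rho x 0 = mu x

end

/-! Along a trajectory, `log ρ_θ` changes at rate `-∇·v`, by expanding the divergence in the
Liouville equation. Also `log ρ_*` changes at rate `S_*·v + ∂ₜ log ρ̃ - Z'/Z`, and `Z'/Z` is the
expectation in the residual. So `ε` is the rate of change of `log (ρ_*/ρ_θ)`, which starts at `0`
because both densities equal `μ` at time `0`. The delicate term is `Z`: it is only a primitive of an
integrable function, so `log Z` is handled by absolute continuity (`integral_div_eq_log_sub_log`).

For the reweighting, the flow map `x₀ ↦ X x₀ t` is shown to be injective and differentiable, and its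
Jacobian determinant is `exp ∫ ∇·v` by Liouville's formula
(`IsTrajectoryFamily.exists_hasFDerivAt_det`). Hence `|det J| ρ_θ(X) = μ`, so the image of the flow
carries `ρ_θ`-mass `∫ μ = 1`, that is, all of it. The flow need not be onto, but domination makes
the complement of its image `ρ_*`-null, hence Lebesgue-null since `ρ_* > 0`. The change of variables
formula then gives the claim. -/

/-! ### Integration against a density. -/

section Density

variable {D : ℕ} {p : Space D → ℝ}

lemma integral_densityMeasure (hp : Measurable p) (h0 : ∀ x, 0 ≤ p x) (F : Space D → ℝ) :
    ∫ x, F x ∂(densityMeasure p) = ∫ x, p x * F x := by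
  rw [densityMeasure, integral_withDensity_eq_integral_toReal_smul hp.ennreal_ofReal
    (ae_of_all _ fun _ => ENNReal.ofReal_lt_top)]
  simp only [ENNReal.toReal_ofReal (h0 _), smul_eq_mul]

lemma integrable_densityMeasure_iff (hp : Measurable p) (h0 : ∀ x, 0 ≤ p x) (F : Space D → ℝ) :
    Integrable F (densityMeasure p) ↔ Integrable (fun x => p x * F x) := by
  rw [densityMeasure, integrable_withDensity_iff_integrable_smul' hp.ennreal_ofReal
    (ae_of_all _ fun _ => ENNReal.ofReal_lt_top)]
  simp only [ENNReal.toReal_ofReal (h0 _), smul_eq_mul]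

end Density

/-! ### Calculus on the closed slab, with one-sided time derivatives. -/

section Calculus

variable {D : ℕ} {f : Space D → ℝ → ℝ}

/-- The slab `ℝ^D × [0,1]` has unique derivatives. -/
lemma uniqueDiffOn_slab (D : ℕ) :
    UniqueDiffOn ℝ ((univ : Set (Space D)) ×ˢ Icc (0 : ℝ) 1) :=
  uniqueDiffOn_univ.prod (uniqueDiffOn_Icc zero_lt_one)

variable (hf : ContDiffOn ℝ 1 (fun p : Space D × ℝ => f p.1 p.2) (univ ×ˢ Icc 0 1))
include hf

lemma ContDiffOn.hasFDerivWithinAt_slab (x : Space D) {t : ℝ} (ht : t ∈ Icc (0 : ℝ) 1) :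
    HasFDerivWithinAt (fun p : Space D × ℝ => f p.1 p.2)
      (fderivWithin ℝ (fun p : Space D × ℝ => f p.1 p.2) (univ ×ˢ Icc 0 1) (x, t))
      (univ ×ˢ Icc 0 1) (x, t) :=
  ((hf.differentiableOn one_ne_zero) (x, t) ⟨mem_univ _, ht⟩).hasFDerivWithinAt

lemma ContDiffOn.hasFDerivAt_slice (x : Space D) {t : ℝ} (ht : t ∈ Icc (0 : ℝ) 1) :
    HasFDerivAt (fun y => f y t)
      ((fderivWithin ℝ (fun p : Space D × ℝ => f p.1 p.2) (univ ×ˢ Icc 0 1) (x, t)).comp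
        (ContinuousLinearMap.inl ℝ (Space D) ℝ)) x := by
  have h1 : HasFDerivWithinAt (fun y : Space D => (y, t)) (ContinuousLinearMap.inl ℝ (Space D) ℝ)
      univ x := (hasFDerivAt_prodMk_left x t).hasFDerivWithinAt
  have hm : MapsTo (fun y : Space D => (y, t)) univ (univ ×ˢ Icc 0 1) :=
    fun y _ => ⟨mem_univ _, ht⟩
  have := (hf.hasFDerivWithinAt_slab x ht).comp x h1 hm
  exact hasFDerivWithinAt_univ.1 this

lemma ContDiffOn.timeDeriv_eq (x : Space D) {t : ℝ} (ht : t ∈ Icc (0 : ℝ) 1) :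
    timeDeriv f x t =
      fderivWithin ℝ (fun p : Space D × ℝ => f p.1 p.2) (univ ×ˢ Icc 0 1) (x, t) (0, 1) := by
  have h1 : HasDerivWithinAt (fun s : ℝ => (x, s)) ((0 : Space D), (1 : ℝ)) (Icc 0 1) t :=
    (hasDerivWithinAt_const t _ x).prodMk (hasDerivWithinAt_id t _)
  have hm : MapsTo (fun s : ℝ => (x, s)) (Icc 0 1) (univ ×ˢ Icc 0 1) :=
    fun s hs => ⟨mem_univ _, hs⟩
  have := (hf.hasFDerivWithinAt_slab x ht).comp_hasDerivWithinAt t h1 hm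
  exact this.derivWithin (uniqueDiffOn_Icc zero_lt_one t ht)

/-- Chain rule for a time-dependent function along a curve. -/
lemma ContDiffOn.hasDerivWithinAt_along {γ : ℝ → Space D} {γ' : Space D} {t : ℝ}
    (ht : t ∈ Icc (0 : ℝ) 1) (hγ : HasDerivWithinAt γ γ' (Icc 0 1) t) :
    HasDerivWithinAt (fun s => f (γ s) s)
      (fderiv ℝ (fun y => f y t) (γ t) γ' + timeDeriv f (γ t) t) (Icc 0 1) t := by
  have h1 : HasDerivWithinAt (fun s : ℝ => (γ s, s)) (γ', (1 : ℝ)) (Icc 0 1) t :=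
    hγ.prodMk (hasDerivWithinAt_id t _)
  have hm : MapsTo (fun s : ℝ => (γ s, s)) (Icc 0 1) (univ ×ˢ Icc 0 1) :=
    fun s hs => ⟨mem_univ _, hs⟩
  have := (hf.hasFDerivWithinAt_slab (γ t) ht).comp_hasDerivWithinAt_of_eq t h1 hm rfl
  refine this.congr_deriv ?_
  rw [(hf.hasFDerivAt_slice (γ t) ht).fderiv, hf.timeDeriv_eq (γ t) ht,
    ContinuousLinearMap.comp_apply, ← map_add]
  simp

lemma ContDiffOn.hasDerivWithinAt_timeDeriv (x : Space D) {t : ℝ} (ht : t ∈ Icc (0 : ℝ) 1) :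
    HasDerivWithinAt (f x) (timeDeriv f x t) (Icc 0 1) t := by
  simpa using hf.hasDerivWithinAt_along ht (hasDerivWithinAt_const t (Icc 0 1) x)

lemma ContDiffOn.continuousOn_timeDeriv :
    ContinuousOn (fun p : Space D × ℝ => timeDeriv f p.1 p.2) (univ ×ˢ Icc 0 1) := by
  have h := hf.continuousOn_fderivWithin (uniqueDiffOn_slab D) le_rfl
  refine (h.clm_apply (continuousOn_const (c := ((0 : Space D), (1 : ℝ))))).congr fun p hp => ?_
  exact hf.timeDeriv_eq p.1 hp.2

lemma ContDiffOn.continuousOn_fderiv_slice :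
    ContinuousOn (fun p : Space D × ℝ => fderiv ℝ (fun y => f y p.2) p.1) (univ ×ˢ Icc 0 1) := by
  have h := hf.continuousOn_fderivWithin (uniqueDiffOn_slab D) le_rfl
  refine (h.clm_comp (continuousOn_const (c := ContinuousLinearMap.inl ℝ (Space D) ℝ))).congr fun p hp => ?_
  exact (hf.hasFDerivAt_slice p.1 hp.2).fderiv

lemma ContDiffOn.continuous_slice {t : ℝ} (ht : t ∈ Icc (0 : ℝ) 1) :
    Continuous (fun x => f x t) :=
  continuous_iff_continuousAt.2 fun x => (hf.hasFDerivAt_slice x ht).continuousAt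

lemma ContDiffOn.integral_timeDeriv (x : Space D) {t : ℝ} (ht : t ∈ Icc (0 : ℝ) 1) :
    ∫ s in (0 : ℝ)..t, timeDeriv f x s = f x t - f x 0 := by
  have hc : ContinuousOn (fun s => timeDeriv f x s) (Icc 0 1) :=
    hf.continuousOn_timeDeriv.comp (f := fun s : ℝ => (x, s)) (by fun_prop)
      (fun s hs => ⟨mem_univ _, hs⟩)
  have hsub : Icc 0 t ⊆ Icc (0 : ℝ) 1 := Icc_subset_Icc_right ht.2
  refine intervalIntegral.integral_eq_sub_of_hasDeriv_right_of_le ht.1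
    (fun s hs => ((hf.hasDerivWithinAt_timeDeriv x (hsub hs)).continuousWithinAt).mono hsub)
    (fun s hs => ?_) ?_
  · exact (hf.hasDerivWithinAt_timeDeriv x (hsub (Ioo_subset_Icc_self hs))).mono_of_mem_nhdsWithin
      (mem_nhdsWithin_of_mem_nhds (Icc_mem_nhds hs.1 (hs.2.trans_le ht.2)))
  · exact (hc.mono (by rwa [uIcc_of_le ht.1])).intervalIntegrable

end Calculus

/-! ### Logarithms of absolutely continuous functions. -/

section AbsolutelyContinuous

open Filter Topology

/-- A Lipschitz map enlarges each sum of increments by at most the factor `K`. It is needed for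
`log` on a half-line `[m, ∞)` with `m > 0`. -/
lemma LipschitzOnWith.comp_absolutelyContinuousOnInterval {f g : ℝ → ℝ} {a b : ℝ} {K : NNReal}
    {s : Set ℝ} (hg : LipschitzOnWith K g s) (hf : AbsolutelyContinuousOnInterval f a b)
    (hs : MapsTo f (uIcc a b) s) : AbsolutelyContinuousOnInterval (fun x => g (f x)) a b := by
  have h : Tendsto (fun E : ℕ × (ℕ → ℝ × ℝ) =>
      K * ∑ i ∈ Finset.range E.1, dist (f (E.2 i).1) (f (E.2 i).2))
      (AbsolutelyContinuousOnInterval.totalLengthFilter ⊓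
        𝓟 (AbsolutelyContinuousOnInterval.disjWithin a b)) (𝓝 0) := by
    simpa using Tendsto.const_mul (K : ℝ) hf
  refine squeeze_zero' (Eventually.of_forall fun E => Finset.sum_nonneg fun _ _ => dist_nonneg)
    ?_ h
  filter_upwards [mem_inf_of_right (mem_principal_self _)] with E hE
  rw [Finset.mul_sum]
  exact Finset.sum_le_sum fun i hi =>
    hg.dist_le_mul _ (hs (hE.1 i hi).1) _ (hs (hE.1 i hi).2)

/-- The logarithm of a positive primitive is a primitive of the logarithmic derivative. -/
lemma integral_div_eq_log_sub_log {Z g : ℝ → ℝ} (hg : IntervalIntegrable g volume 0 1)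
    (hZ : ∀ t ∈ Icc (0 : ℝ) 1, Z t = Z 0 + ∫ s in (0 : ℝ)..t, g s)
    (hpos : ∀ t ∈ Icc (0 : ℝ) 1, 0 < Z t) :
    IntervalIntegrable (fun s => g s / Z s) volume 0 1 ∧
    ∀ t ∈ Icc (0 : ℝ) 1, ∫ s in (0 : ℝ)..t, g s / Z s = Real.log (Z t) - Real.log (Z 0) := by
  have h01 : uIcc (0 : ℝ) 1 = Icc 0 1 := uIcc_of_le zero_le_one
  -- `W` agrees with `Z` on `[0,1]` and is a primitive on both sides of each point, so it can have a
  -- two-sided derivative where `Z` is not controlled outside.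
  set W : ℝ → ℝ := fun t => Z 0 + ∫ s in (0 : ℝ)..t, g s with hW
  have hZW : ∀ t ∈ Icc (0 : ℝ) 1, Z t = W t := hZ
  have hWpos : ∀ t ∈ Icc (0 : ℝ) 1, 0 < W t := fun t ht => hZW t ht ▸ hpos t ht
  have hac : AbsolutelyContinuousOnInterval W 0 1 := by
    have h1 := hg.absolutelyContinuousOnInterval_intervalIntegral (c := 0) (by simp)
    have h2 : AbsolutelyContinuousOnInterval (fun _ : ℝ => Z 0) 0 1 :=
      ((LipschitzWith.const (Z 0)).lipschitzOnWith).absolutelyContinuousOnInterval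
    exact h2.add h1
  have hcont : ContinuousOn W (Icc 0 1) := h01 ▸ hac.continuousOn
  -- The positive minimum of `W` keeps its values away from the singularity of `log`.
  obtain ⟨t₀, ht₀, hmin⟩ := isCompact_Icc.exists_isMinOn (nonempty_Icc.2 zero_le_one) hcont
  have hm : 0 < W t₀ := hWpos t₀ ht₀
  have hlip : LipschitzOnWith (Real.toNNReal (W t₀)⁻¹) Real.log (Ici (W t₀)) := by
    refine Convex.lipschitzOnWith_of_nnnorm_hasDerivWithin_le (convex_Ici _)
      (f' := fun x => x⁻¹)
      (fun x hx => (Real.hasDerivAt_log (hm.trans_le hx).ne').hasDerivWithinAt) fun x hx => ?_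
    have hx0 : 0 < x := hm.trans_le hx
    rw [← NNReal.coe_le_coe, coe_nnnorm, Real.coe_toNNReal _ (inv_pos.2 hm).le,
      Real.norm_of_nonneg (inv_pos.2 hx0).le]
    exact inv_anti₀ hm hx
  have hlog : AbsolutelyContinuousOnInterval (fun t => Real.log (W t)) 0 1 :=
    hlip.comp_absolutelyContinuousOnInterval hac (by rw [h01]; exact fun t ht => hmin ht)
  have hae : ∀ᵐ s, s ∈ Icc (0 : ℝ) 1 → deriv (fun t => Real.log (W t)) s = g s / Z s := by
    filter_upwards [hg.ae_hasDerivAt_integral] with s hs hs1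
    have h := (hs (h01 ▸ hs1) 0 (by simp)).const_add (Z 0)
    rw [hZW s hs1]
    exact (h.log (hWpos s hs1).ne').deriv
  have hint : IntervalIntegrable (fun s => g s / Z s) volume 0 1 := by
    refine hlog.intervalIntegrable_deriv.congr_ae ?_
    rw [uIoc_of_le zero_le_one]
    refine (ae_restrict_iff' measurableSet_Ioc).2 ?_
    filter_upwards [hae] with s hs hs1 using hs (Ioc_subset_Icc_self hs1)
  refine ⟨hint, fun t ht => ?_⟩
  have h1 := (hlog.mono (c := 0) (d := t)
    (by rw [h01, uIcc_of_le ht.1]; exact Icc_subset_Icc_right ht.2)).integral_deriv_eq_sub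
  have h0 : W 0 = Z 0 := (hZW 0 ⟨le_rfl, zero_le_one⟩).symm
  rw [h0, ← hZW t ht] at h1
  rw [← h1]
  refine intervalIntegral.integral_congr_ae ?_
  filter_upwards [hae] with s hs hs1
  rw [uIoc_of_le ht.1] at hs1
  exact (hs ⟨hs1.1.le, hs1.2.trans ht.2⟩).symm

end AbsolutelyContinuous

/-! ### The partition function and its logarithmic derivative. -/

section Partition

variable {D : ℕ} {rhoU : Space D → ℝ → ℝ} (h : IsUnnormalizedPath rhoU)
include h

lemma IsUnnormalizedPath.partitionFunction_pos {t : ℝ} (ht : t ∈ Icc (0 : ℝ) 1) :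
    0 < partitionFunction rhoU t := by
  refine integral_pos_of_integrable_nonneg_nonzero (x := 0) (h.contDiffOn.continuous_slice ht)
    (h.integrable t ht) (fun x => (h.pos x t ht).le) (h.pos 0 t ht).ne'

lemma IsUnnormalizedPath.targetDensity_pos (x : Space D) {t : ℝ} (ht : t ∈ Icc (0 : ℝ) 1) :
    0 < targetDensity rhoU x t :=
  div_pos (h.pos x t ht) (h.partitionFunction_pos ht)

lemma IsUnnormalizedPath.continuous_targetDensity {t : ℝ} (ht : t ∈ Icc (0 : ℝ) 1) :
    Continuous fun x => targetDensity rhoU x t :=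
  (h.contDiffOn.continuous_slice ht).div_const _

lemma IsUnnormalizedPath.integrable_prod_timeDeriv :
    Integrable (fun p : Space D × ℝ => timeDeriv rhoU p.1 p.2)
      (volume.prod (volume.restrict (Icc 0 1))) := by
  have := h.integrableOn_timeDeriv
  rwa [IntegrableOn, Measure.volume_eq_prod, ← Measure.prod_restrict, Measure.restrict_univ] at this

lemma IsUnnormalizedPath.intervalIntegrable_integral_timeDeriv :
    IntervalIntegrable (fun s => ∫ x, timeDeriv rhoU x s) volume 0 1 := by
  rw [intervalIntegrable_iff_integrableOn_Icc_of_le zero_le_one]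
  exact h.integrable_prod_timeDeriv.integral_prod_right

/-- Differentiation of the partition function under the integral sign, in integrated form. -/
lemma IsUnnormalizedPath.partitionFunction_eq {t : ℝ} (ht : t ∈ Icc (0 : ℝ) 1) :
    partitionFunction rhoU t =
      partitionFunction rhoU 0 + ∫ s in (0 : ℝ)..t, ∫ x, timeDeriv rhoU x s := by
  have h0 : (0 : ℝ) ∈ Icc (0 : ℝ) 1 := ⟨le_rfl, zero_le_one⟩
  have hint : Integrable (fun p : Space D × ℝ => timeDeriv rhoU p.1 p.2)
      (volume.prod (volume.restrict (Ioc 0 t))) :=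
    h.integrable_prod_timeDeriv.mono_measure (Measure.prod_mono le_rfl
      (Measure.restrict_mono (Ioc_subset_Icc_self.trans (Icc_subset_Icc_right ht.2)) le_rfl))
  -- Fubini reduces the claim to the fundamental theorem of calculus at each fixed `x`.
  have hswap := integral_integral_swap (f := fun x s => timeDeriv rhoU x s) hint
  rw [intervalIntegral.integral_of_le ht.1, ← hswap, partitionFunction, partitionFunction,
    ← sub_eq_iff_eq_add', ← integral_sub (h.integrable t ht) (h.integrable 0 h0)]
  refine integral_congr_ae (ae_of_all _ fun x => ?_)
  simp only [← intervalIntegral.integral_of_le ht.1]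
  exact (h.contDiffOn.integral_timeDeriv x ht).symm

lemma IsUnnormalizedPath.timeDeriv_log (x : Space D) {t : ℝ} (ht : t ∈ Icc (0 : ℝ) 1) :
    timeDeriv (fun y s => Real.log (rhoU y s)) x t = timeDeriv rhoU x t / rhoU x t :=
  ((h.contDiffOn.hasDerivWithinAt_timeDeriv x ht).log (h.pos x t ht).ne').derivWithin
    (uniqueDiffOn_Icc zero_lt_one t ht)

/-- The expected time derivative of `log ρ̃` is the logarithmic derivative of the partition
function. -/
lemma IsUnnormalizedPath.integral_timeDeriv_log {t : ℝ} (ht : t ∈ Icc (0 : ℝ) 1) :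
    ∫ y, timeDeriv (fun z s => Real.log (rhoU z s)) y t
        ∂(densityMeasure (fun y => targetDensity rhoU y t)) =
      (∫ x, timeDeriv rhoU x t) / partitionFunction rhoU t := by
  rw [integral_densityMeasure (h.continuous_targetDensity ht).measurable
    (fun x => (h.targetDensity_pos x ht).le), ← integral_div]
  refine integral_congr_ae (ae_of_all _ fun x => ?_)
  have h1 := (h.pos x t ht).ne'
  have h2 := (h.partitionFunction_pos ht).ne'
  simp only [h.timeDeriv_log x ht, targetDensity]
  field_simp

end Partition

/-! ### Product rule for the divergence. -/

section Divergence

variable {D : ℕ}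

lemma divergence_smul {f : Space D → ℝ} {V : Space D → Space D} {x : Space D}
    (hf : DifferentiableAt ℝ f x) (hV : DifferentiableAt ℝ V x) :
    divergence (fun y => f y • V y) x = fderiv ℝ f x (V x) + f x * divergence V x := by
  have h1 : ∀ i : Fin D, (fderiv ℝ (fun y => f y • V y) x (EuclideanSpace.single i 1)) i =
      V x i * fderiv ℝ f x (EuclideanSpace.single i 1) +
        f x * (fderiv ℝ V x (EuclideanSpace.single i 1)) i := by
    intro i
    rw [fderiv_fun_smul hf hV]
    simp
    ring
  have h2 : V x = ∑ i, V x i • EuclideanSpace.single i (1 : ℝ) := by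
    simpa using ((EuclideanSpace.basisFun (Fin D) ℝ).sum_repr (V x)).symm
  simp only [divergence, h1, Finset.sum_add_distrib, ← Finset.mul_sum]
  congr 1
  conv_rhs => rw [h2]
  simp

end Divergence

/-! ### Scalar linear differential equations. -/

section LinearODE

lemma hasDerivWithinAt_integral_Icc {b : ℝ → ℝ} (hb : ContinuousOn b (Icc 0 1)) {t : ℝ}
    (ht : t ∈ Icc (0 : ℝ) 1) :
    HasDerivWithinAt (fun u => ∫ s in (0 : ℝ)..u, b s) (b t) (Icc 0 1) t := by
  -- This `Fact` makes available the `FTCFilter` instance for one-sided derivatives within `Icc 0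
  -- 1`.
  have : Fact (t ∈ Icc (0 : ℝ) 1) := ⟨ht⟩
  refine intervalIntegral.integral_hasDerivWithinAt_right ?_ ?_ (hb t ht)
  · exact (hb.mono (by rw [uIcc_of_le ht.1]; exact Icc_subset_Icc_right ht.2)).intervalIntegrable
  · exact hb.stronglyMeasurableAtFilter_nhdsWithin measurableSet_Icc t

/-- A solution of a scalar linear differential equation is an exponential. -/
lemma eq_mul_exp_integral {p b : ℝ → ℝ} (hb : ContinuousOn b (Icc 0 1))
    (hp : ∀ t ∈ Icc (0 : ℝ) 1, HasDerivWithinAt p (b t * p t) (Icc 0 1) t) {t : ℝ}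
    (ht : t ∈ Icc (0 : ℝ) 1) : p t = p 0 * Real.exp (∫ s in (0 : ℝ)..t, b s) := by
  -- Integrating factor: the product with `exp (-∫ b)` is constant.
  have hq : ∀ u ∈ Icc (0 : ℝ) 1,
      HasDerivWithinAt (fun u => p u * Real.exp (-∫ s in (0 : ℝ)..u, b s)) 0 (Icc 0 1) u := by
    intro u hu
    refine ((hp u hu).mul (hasDerivWithinAt_integral_Icc hb hu).neg.exp).congr_deriv ?_
    ring
  have hc := constant_of_derivWithin_zero (fun u hu => (hq u hu).differentiableWithinAt)
    (fun u hu => (hq u (Ico_subset_Icc_self hu)).derivWithin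
      (uniqueDiffOn_Icc zero_lt_one u (Ico_subset_Icc_self hu))) t ht
  simp only [intervalIntegral.integral_same, neg_zero, Real.exp_zero, mul_one] at hc
  rw [← hc, mul_assoc, ← Real.exp_add]
  simp

end LinearODE

/-! ### Densities and residual along a trajectory. -/

section Trajectory

variable {D : ℕ} {mu : Space D → ℝ} {rhoU : Space D → ℝ → ℝ} {v : Space D → ℝ → Space D}
  {X : Space D → ℝ → Space D} {rhoTheta : Space D → ℝ → ℝ}

lemma IsTrajectoryFamily.continuousOn (hX : IsTrajectoryFamily v X) (x₀ : Space D) :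
    ContinuousOn (X x₀) (Icc 0 1) :=
  fun t ht => (hX.deriv x₀ t ht).continuousWithinAt

lemma IsRegularVelocity.continuousOn_fderiv_along (hv : IsRegularVelocity v) {γ : ℝ → Space D}
    (hγ : ContinuousOn γ (Icc 0 1)) :
    ContinuousOn (fun t => fderiv ℝ (fun y => v y t) (γ t)) (Icc 0 1) :=
  hv.continuousOn_fderiv.comp (f := fun t : ℝ => (γ t, t)) (hγ.prodMk continuousOn_id)
    fun _ ht => ⟨mem_univ _, ht⟩

lemma IsRegularVelocity.continuousOn_along (hv : IsRegularVelocity v) {γ : ℝ → Space D}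
    (hγ : ContinuousOn γ (Icc 0 1)) :
    ContinuousOn (fun t => v (γ t) t) (Icc 0 1) :=
  hv.continuousOn.comp (f := fun t : ℝ => (γ t, t)) (hγ.prodMk continuousOn_id)
    fun _ ht => ⟨mem_univ _, ht⟩

lemma IsRegularVelocity.continuousOn_divergence_along (hv : IsRegularVelocity v)
    {γ : ℝ → Space D} (hγ : ContinuousOn γ (Icc 0 1)) :
    ContinuousOn (fun t => divergence (fun y => v y t) (γ t)) (Icc 0 1) := by
  unfold divergence
  refine continuousOn_finsetSum _ fun i _ => ?_
  have h := (hv.continuousOn_fderiv_along hγ).clm_apply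
    (continuousOn_const (c := EuclideanSpace.single i (1 : ℝ)))
  exact (EuclideanSpace.proj (𝕜 := ℝ) i).continuous.comp_continuousOn h

/-- Along trajectories, a solution of the Liouville equation is damped exponentially by the
divergence of the velocity. -/
lemma IsLiouvilleDensity.eq_mul_exp (hrho : IsLiouvilleDensity v mu rhoTheta)
    (hv : IsRegularVelocity v) (hX : IsTrajectoryFamily v X) (x₀ : Space D) {t : ℝ}
    (ht : t ∈ Icc (0 : ℝ) 1) :
    rhoTheta (X x₀ t) t =
      mu x₀ * Real.exp (-∫ s in (0 : ℝ)..t, divergence (fun y => v y s) (X x₀ s)) := by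
  have hb := (hv.continuousOn_divergence_along (hX.continuousOn x₀)).neg
  have h := eq_mul_exp_integral (p := fun s => rhoTheta (X x₀ s) s) hb (fun s hs => ?_) ht
  · simpa [hX.initial, hrho.initial] using h
  · refine (hrho.contDiffOn.hasDerivWithinAt_along hs (hX.deriv x₀ s hs)).congr_deriv ?_
    rw [hrho.liouville _ s hs, divergence_smul (f := fun y => rhoTheta y s)
      (hrho.contDiffOn.hasFDerivAt_slice _ hs).differentiableAt (hv.differentiable s hs _)]
    simp only [Pi.neg_apply]
    ring

/-- The normalization contributes only a constant in `x` to `log ρ_*`, so it drops out of the score.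
-/
lemma IsUnnormalizedPath.inner_targetScore (h : IsUnnormalizedPath rhoU) (x w : Space D) {t : ℝ}
    (ht : t ∈ Icc (0 : ℝ) 1) :
    inner ℝ (targetScore rhoU x t) w = fderiv ℝ (fun y => rhoU y t) x w / rhoU x t := by
  have h1 := (h.contDiffOn.hasFDerivAt_slice x ht).differentiableAt.hasFDerivAt
  have hZ := (h.partitionFunction_pos ht).ne'
  have h2 : HasFDerivAt (fun y => Real.log (targetDensity rhoU y t))
      ((rhoU x t)⁻¹ • fderiv ℝ (fun y => rhoU y t) x) x := by
    have h3 := (h1.log (h.pos x t ht).ne').sub_const (Real.log (partitionFunction rhoU t))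
    refine h3.congr_of_eventuallyEq (Filter.Eventually.of_forall fun y => ?_)
    exact Real.log_div (h.pos y t ht).ne' hZ
  rw [targetScore, gradient, InnerProductSpace.toDual_symm_apply, h2.fderiv]
  simp [div_eq_inv_mul]

variable (hrhoU : IsUnnormalizedPath rhoU) (hmu : ∀ x, targetDensity rhoU x 0 = mu x)
  (hv : IsRegularVelocity v) (hX : IsTrajectoryFamily v X)

include hrhoU hv hX in
/-- The residual along a trajectory integrates to the divergence of the velocity plus the
increment of `log ρ_*`. -/
lemma integral_velocityResidual (x₀ : Space D) :
    IntervalIntegrable (fun s => velocityResidual v rhoU (X x₀ s) s) volume 0 1 ∧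
    ∀ t ∈ Icc (0 : ℝ) 1, ∫ s in (0 : ℝ)..t, velocityResidual v rhoU (X x₀ s) s =
      (∫ s in (0 : ℝ)..t, divergence (fun y => v y s) (X x₀ s)) +
        (Real.log (targetDensity rhoU (X x₀ t) t) - Real.log (targetDensity rhoU x₀ 0)) := by
  have h0 : (0 : ℝ) ∈ Icc (0 : ℝ) 1 := ⟨le_rfl, zero_le_one⟩
  have hγ := hX.continuousOn x₀
  set a : ℝ → ℝ := fun s => divergence (fun y => v y s) (X x₀ s) with ha
  set l : ℝ → ℝ := fun s => (fderiv ℝ (fun y => rhoU y s) (X x₀ s) (v (X x₀ s) s) +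
    timeDeriv rhoU (X x₀ s) s) / rhoU (X x₀ s) s with hl
  set z : ℝ → ℝ := fun s => (∫ x, timeDeriv rhoU x s) / partitionFunction rhoU s with hz
  -- The residual splits into `a` and `l`, continuous along the curve, and `z = Z'/Z`, which is only
  -- known to be integrable.
  have heq : ∀ s ∈ Icc (0 : ℝ) 1, a s + l s - z s = velocityResidual v rhoU (X x₀ s) s := by
    intro s hs
    rw [velocityResidual, centeredLogDeriv, hrhoU.integral_timeDeriv_log hs,
      hrhoU.timeDeriv_log _ hs, hrhoU.inner_targetScore _ _ hs]
    simp only [ha, hl, hz]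
    ring
  obtain ⟨hzint, hzeq⟩ := integral_div_eq_log_sub_log hrhoU.intervalIntegrable_integral_timeDeriv
    (fun t ht => hrhoU.partitionFunction_eq ht) (fun t ht => hrhoU.partitionFunction_pos ht)
  have hac : ContinuousOn a (Icc 0 1) := hv.continuousOn_divergence_along hγ
  have hmaps : MapsTo (fun s : ℝ => (X x₀ s, s)) (Icc 0 1) (univ ×ˢ Icc 0 1) :=
    fun s hs => ⟨mem_univ _, hs⟩
  have hpair : ContinuousOn (fun s : ℝ => (X x₀ s, s)) (Icc 0 1) := hγ.prodMk continuousOn_id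
  have hlc : ContinuousOn l (Icc 0 1) := by
    refine ContinuousOn.div (ContinuousOn.add ?_ ?_) ?_ fun s hs => (hrhoU.pos _ s hs).ne'
    · exact (hrhoU.contDiffOn.continuousOn_fderiv_slice.comp hpair hmaps).clm_apply
        (hv.continuousOn_along hγ)
    · exact hrhoU.contDiffOn.continuousOn_timeDeriv.comp hpair hmaps
    · exact hrhoU.contDiffOn.continuousOn.comp hpair hmaps
  have hL : ∀ s ∈ Icc (0 : ℝ) 1,
      HasDerivWithinAt (fun s => Real.log (rhoU (X x₀ s) s)) (l s) (Icc 0 1) s := fun s hs =>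
    (hrhoU.contDiffOn.hasDerivWithinAt_along hs (hX.deriv x₀ s hs)).log (hrhoU.pos _ s hs).ne'
  have hsub : ∀ t ∈ Icc (0 : ℝ) 1, uIcc 0 t ⊆ Icc 0 1 := fun t ht => by
    rw [uIcc_of_le ht.1]; exact Icc_subset_Icc_right ht.2
  have hai : ∀ t ∈ Icc (0 : ℝ) 1, IntervalIntegrable a volume 0 t :=
    fun t ht => (hac.mono (hsub t ht)).intervalIntegrable
  have hli : ∀ t ∈ Icc (0 : ℝ) 1, IntervalIntegrable l volume 0 t :=
    fun t ht => (hlc.mono (hsub t ht)).intervalIntegrable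
  have hzi : ∀ t ∈ Icc (0 : ℝ) 1, IntervalIntegrable z volume 0 t :=
    fun t ht => hzint.mono_set (by rw [uIcc_of_le zero_le_one]; exact hsub t ht)
  have h1 : (1 : ℝ) ∈ Icc (0 : ℝ) 1 := ⟨zero_le_one, le_rfl⟩
  refine ⟨(((hai 1 h1).add (hli 1 h1)).sub (hzi 1 h1)).congr fun s hs => ?_, fun t ht => ?_⟩
  · rw [uIoc_of_le zero_le_one] at hs
    exact heq s (Ioc_subset_Icc_self hs)
  have hli_eq : ∫ s in (0 : ℝ)..t, l s =
      Real.log (rhoU (X x₀ t) t) - Real.log (rhoU (X x₀ 0) 0) := by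
    have hst : Icc 0 t ⊆ Icc (0 : ℝ) 1 := Icc_subset_Icc_right ht.2
    refine intervalIntegral.integral_eq_sub_of_hasDeriv_right_of_le ht.1
      (fun s hs => ((hL s (hst hs)).continuousWithinAt).mono hst) (fun s hs => ?_) (hli t ht)
    exact (hL s (hst (Ioo_subset_Icc_self hs))).mono_of_mem_nhdsWithin
      (mem_nhdsWithin_of_mem_nhds (Icc_mem_nhds hs.1 (hs.2.trans_le ht.2)))
  rw [← intervalIntegral.integral_congr fun s hs => heq s (hsub t ht hs),
    intervalIntegral.integral_sub ((hai t ht).add (hli t ht)) (hzi t ht),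
    intervalIntegral.integral_add (hai t ht) (hli t ht), hli_eq, hzeq t ht, targetDensity,
    targetDensity, Real.log_div (hrhoU.pos _ t ht).ne' (hrhoU.partitionFunction_pos ht).ne',
    Real.log_div (hrhoU.pos _ 0 h0).ne' (hrhoU.partitionFunction_pos h0).ne', hX.initial]
  ring

include hrhoU hmu in
lemma IsUnnormalizedPath.initial_pos (x₀ : Space D) : 0 < mu x₀ :=
  hmu x₀ ▸ hrhoU.targetDensity_pos x₀ ⟨le_rfl, zero_le_one⟩

include hrhoU hmu hv hX in
lemma IsLiouvilleDensity.pos_along (hrho : IsLiouvilleDensity v mu rhoTheta) (x₀ : Space D)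
    {t : ℝ} (ht : t ∈ Icc (0 : ℝ) 1) : 0 < rhoTheta (X x₀ t) t := by
  rw [hrho.eq_mul_exp hv hX x₀ ht]
  exact mul_pos (hrhoU.initial_pos hmu x₀) (Real.exp_pos _)

include hrhoU hmu hv hX in
-- The integrals of `∇·v` in `log ρ_θ` and in the integrated residual match, and the initial terms
-- cancel since both densities start at `μ`.
lemma log_targetDensity_div (hrho : IsLiouvilleDensity v mu rhoTheta) (x₀ : Space D) {t : ℝ}
    (ht : t ∈ Icc (0 : ℝ) 1) :
    Real.log (targetDensity rhoU (X x₀ t) t / rhoTheta (X x₀ t) t) =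
      ∫ s in (0 : ℝ)..t, velocityResidual v rhoU (X x₀ s) s := by
  rw [Real.log_div (hrhoU.targetDensity_pos _ ht).ne'
    (hrho.pos_along hrhoU hmu hv hX x₀ ht).ne', hrho.eq_mul_exp hv hX x₀ ht,
    Real.log_mul (hrhoU.initial_pos hmu x₀).ne' (Real.exp_pos _).ne', Real.log_exp,
    (integral_velocityResidual hrhoU hv hX x₀).2 t ht, hmu]
  ring

include hrhoU hmu hv hX in
lemma targetDensity_div_eq_pathWeight (hrho : IsLiouvilleDensity v mu rhoTheta) (x₀ : Space D)
    {t : ℝ} (ht : t ∈ Icc (0 : ℝ) 1) :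
    targetDensity rhoU (X x₀ t) t / rhoTheta (X x₀ t) t = pathWeight v rhoU X t x₀ := by
  rw [pathWeight, ← log_targetDensity_div hrhoU hmu hv hX hrho x₀ ht, Real.exp_log]
  exact div_pos (hrhoU.targetDensity_pos _ ht) (hrho.pos_along hrhoU hmu hv hX x₀ ht)

end Trajectory

/-! ### Existence for linear systems, by Picard iteration in a weighted norm. -/

section LinearSystem

variable {V : Type*} [NormedAddCommGroup V] [NormedSpace ℝ V] [CompleteSpace V]

/-- Linear differential equations with continuous coefficients are solvable on `[0,1]`. -/
lemma exists_linear_ode_solution {A : ℝ → V →L[ℝ] V} (hA : ContinuousOn A (Icc 0 1)) (c : V) :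
    ∃ u : ℝ → V, u 0 = c ∧
      ∀ t ∈ Icc (0 : ℝ) 1, HasDerivWithinAt u (A t (u t)) (Icc 0 1) t := by
  have h01 : (0 : ℝ) ≤ 1 := zero_le_one
  obtain ⟨K, hK⟩ := isCompact_Icc.exists_bound_of_continuousOn hA
  have hK0 : 0 ≤ K := (norm_nonneg _).trans (hK 0 ⟨le_rfl, h01⟩)
  -- With weight `exp (-l t)` the Picard map has Lipschitz constant `K / l ≤ 1/2`, so one
  -- contraction covers all of `[0,1]`; the `+ 1` keeps `l` positive when `K = 0`.
  set l : ℝ := 2 * K + 1 with hl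
  have hl0 : 0 < l := by positivity
  set B : ℝ → V →L[ℝ] V := fun t => A (projIcc 0 1 h01 t) with hB
  have hBc : Continuous B :=
    (continuousOn_iff_continuous_domRestrict.1 hA).comp continuous_projIcc
  have hBK : ∀ t, ‖B t‖ ≤ K := fun t => hK _ (projIcc 0 1 h01 t).2
  -- A point `w` of the space stands for `exp (-l t) u(t)`: `W` removes the weight, `G` is the
  -- Picard map, and `T` puts the weight back.
  let W : C(Icc (0 : ℝ) 1, V) → ℝ → V := fun w s => Real.exp (l * s) • w (projIcc 0 1 h01 s)
  have hWc : ∀ w, Continuous (W w) := fun w => by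
    have : Continuous fun s => w (projIcc 0 1 h01 s) := w.continuous.comp continuous_projIcc
    fun_prop
  let G : C(Icc (0 : ℝ) 1, V) → ℝ → V := fun w t => c + ∫ s in (0 : ℝ)..t, B s (W w s)
  have hGd : ∀ w t, HasDerivAt (G w) (B t (W w t)) t := fun w t =>
    ((hBc.clm_apply (hWc w)).integral_hasStrictDerivAt 0 t).hasDerivAt.const_add c
  have hGc : ∀ w, Continuous (G w) := fun w =>
    continuous_iff_continuousAt.2 fun t => (hGd w t).continuousAt
  let T : C(Icc (0 : ℝ) 1, V) → C(Icc (0 : ℝ) 1, V) := fun w =>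
    ⟨fun t => Real.exp (-(l * t)) • G w t, by have := hGc w; fun_prop⟩
  have hT : ContractingWith (1 / 2) T := by
    refine ⟨by norm_num, LipschitzWith.of_dist_le_mul fun w₁ w₂ => ?_⟩
    rw [ContinuousMap.dist_le (by positivity)]
    intro t
    set d := dist w₁ w₂ with hd
    have hd0 : 0 ≤ d := dist_nonneg
    have hbound : ‖G w₁ t - G w₂ t‖ ≤ K * d / l * Real.exp (l * t) := by
      refine image_norm_le_of_norm_deriv_right_le_deriv_boundary (f := fun s => G w₁ s - G w₂ s)
        (f' := fun s => B s (W w₁ s) - B s (W w₂ s)) (a := 0) (b := 1)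
        (B := fun s => K * d / l * Real.exp (l * s)) (B' := fun s => K * d * Real.exp (l * s))
        ((hGc w₁).sub (hGc w₂)).continuousOn
        (fun s _ => ((hGd w₁ s).sub (hGd w₂ s)).hasDerivWithinAt) ?_ ?_ ?_ t.2
      · simp only [G, intervalIntegral.integral_same, sub_self, norm_zero]
        positivity
      · intro s
        refine (((hasDerivAt_id s).const_mul l).exp.const_mul (K * d / l)).congr_deriv ?_
        simp only [id]
        field_simp
      · intro s _
        rw [← map_sub, show W w₁ s - W w₂ s = Real.exp (l * s) •
          (w₁ (projIcc 0 1 h01 s) - w₂ (projIcc 0 1 h01 s)) from (smul_sub _ _ _).symm]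
        refine ((B s).le_opNorm _).trans ?_
        rw [norm_smul, Real.norm_of_nonneg (Real.exp_pos _).le, ← dist_eq_norm]
        have h1 := ContinuousMap.dist_apply_le_dist (f := w₁) (g := w₂) (projIcc 0 1 h01 s)
        calc ‖B s‖ * (Real.exp (l * s) * dist (w₁ (projIcc 0 1 h01 s)) (w₂ (projIcc 0 1 h01 s)))
            ≤ K * (Real.exp (l * s) * d) := by gcongr; exact hBK s
          _ = K * d * Real.exp (l * s) := by ring
    have hdist : dist (T w₁ t) (T w₂ t) = Real.exp (-(l * t)) * ‖G w₁ t - G w₂ t‖ := by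
      rw [dist_eq_norm, show T w₁ t - T w₂ t = Real.exp (-(l * t)) • (G w₁ t - G w₂ t) from
        (smul_sub _ _ _).symm, norm_smul, Real.norm_of_nonneg (Real.exp_pos _).le]
    rw [hdist]
    calc Real.exp (-(l * t)) * ‖G w₁ t - G w₂ t‖
        ≤ Real.exp (-(l * t)) * (K * d / l * Real.exp (l * t)) := by gcongr
      _ = K / l * d * (Real.exp (-(l * t)) * Real.exp (l * t)) := by ring
      _ = K / l * d := by rw [← Real.exp_add]; simp
      _ ≤ ((1 / 2 : NNReal) : ℝ) * d := by
        gcongr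
        rw [div_le_iff₀ hl0]
        push_cast
        linarith
  have : Nonempty C(Icc (0 : ℝ) 1, V) := ⟨0⟩
  set w := ContractingWith.fixedPoint T hT with hw
  have hfix : T w = w := hT.fixedPoint_isFixedPt
  refine ⟨G w, by simp [G], fun t ht => ((hGd w t).hasDerivWithinAt).congr_deriv ?_⟩
  have hproj : projIcc 0 1 h01 t = ⟨t, ht⟩ := projIcc_of_mem h01 ht
  have h1 : w ⟨t, ht⟩ = Real.exp (-(l * t)) • G w t := by
    conv_lhs => rw [← hfix]
    rfl
  simp only [hB, W, hproj, h1, smul_smul, ← Real.exp_add]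
  simp

end LinearSystem

/-! ### Stability, differentiability and injectivity of the flow. -/

section Flow

variable {D : ℕ} {v : Space D → ℝ → Space D} {X : Space D → ℝ → Space D}

lemma HasDerivWithinAt.Ici_of_Icc {E : Type*} [NormedAddCommGroup E] [NormedSpace ℝ E]
    {f : ℝ → E} {f' : E} {a b t : ℝ} (h : HasDerivWithinAt f f' (Icc a b) t)
    (ht : t ∈ Ico a b) : HasDerivWithinAt f f' (Ici t) t :=
  h.mono_of_mem_nhdsWithin (Icc_mem_nhdsGE_of_mem ht)

/-- The spatial derivative is bounded on a compact ball times `[0,1]`, and the ball is convex. Only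
such local bounds are available, so later estimates must confine trajectories to a ball. -/
lemma IsRegularVelocity.exists_lipschitzOnWith (hv : IsRegularVelocity v) (R : ℝ) :
    ∃ K : NNReal, ∀ t ∈ Icc (0 : ℝ) 1,
      (∀ y ∈ Metric.closedBall 0 R, ‖fderiv ℝ (fun y => v y t) y‖ ≤ K) ∧
      LipschitzOnWith K (fun y => v y t) (Metric.closedBall 0 R) := by
  have hc : IsCompact (Metric.closedBall (0 : Space D) R ×ˢ Icc (0 : ℝ) 1) :=
    (isCompact_closedBall _ _).prod isCompact_Icc
  obtain ⟨K, hK⟩ := hc.exists_bound_of_continuousOn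
    (hv.continuousOn_fderiv.mono (prod_mono_left (subset_univ _)))
  have hb : ∀ t ∈ Icc (0 : ℝ) 1, ∀ y ∈ Metric.closedBall (0 : Space D) R,
      ‖fderiv ℝ (fun y => v y t) y‖ ≤ K.toNNReal := fun t ht y hy =>
    (hK (y, t) ⟨hy, ht⟩).trans (Real.le_coe_toNNReal K)
  exact ⟨K.toNNReal, fun t ht => ⟨hb t ht,
    (convex_closedBall _ _).lipschitzOnWith_of_nnnorm_fderiv_le
      (fun y _ => hv.differentiable t ht y) fun y hy => hb t ht y hy⟩⟩

/-- The velocity is differentiable in space, uniformly on compact sets. -/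
lemma IsRegularVelocity.exists_uniform_approx (hv : IsRegularVelocity v) (R : ℝ) {ε : ℝ}
    (hε : 0 < ε) : ∃ η > 0, ∀ t ∈ Icc (0 : ℝ) 1, ∀ y ∈ Metric.closedBall (0 : Space D) R,
      ∀ z ∈ Metric.closedBall (0 : Space D) R, dist y z ≤ η →
        ‖v y t - v z t - fderiv ℝ (fun y => v y t) z (y - z)‖ ≤ ε * ‖y - z‖ := by
  have hc : IsCompact (Metric.closedBall (0 : Space D) R ×ˢ Icc (0 : ℝ) 1) :=
    (isCompact_closedBall _ _).prod isCompact_Icc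
  have hu := hc.uniformContinuousOn_of_continuous
    (hv.continuousOn_fderiv.mono (prod_mono_left (subset_univ _)))
  obtain ⟨δ, hδ, h⟩ := Metric.uniformContinuousOn_iff.1 hu ε hε
  -- Halving turns the closed condition `dist y z ≤ η` into the strict one of uniform continuity.
  refine ⟨δ / 2, half_pos hδ, fun t ht y hy z hz hyz => ?_⟩
  have hconv : Convex ℝ (Metric.closedBall (0 : Space D) R ∩ Metric.closedBall z (δ / 2)) :=
    (convex_closedBall _ _).inter (convex_closedBall _ _)
  refine hconv.norm_image_sub_le_of_norm_fderiv_le' (f := fun y => v y t)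
    (fun x _ => hv.differentiable t ht x) (fun x hx => ?_)
    ⟨hz, Metric.mem_closedBall_self (half_pos hδ).le⟩ ⟨hy, hyz⟩
  rw [← dist_eq_norm]
  refine (h (x, t) ⟨hx.1, ht⟩ (z, t) ⟨hz, ht⟩ ?_).le
  rw [Prod.dist_eq, dist_self]
  have := Metric.mem_closedBall.1 hx.2
  exact max_lt (by linarith) hδ

lemma IsTrajectoryFamily.exists_bound (hX : IsTrajectoryFamily v X) (x₀ : Space D) :
    ∃ M, ∀ t ∈ Icc (0 : ℝ) 1, ‖X x₀ t‖ ≤ M :=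
  isCompact_Icc.exists_bound_of_continuousOn (hX.continuousOn x₀)

/-- Trajectories starting close to `x₀` stay close to the one of `x₀`. -/
lemma IsTrajectoryFamily.exists_dist_le (hX : IsTrajectoryFamily v X) (hv : IsRegularVelocity v)
    (x₀ : Space D) : ∃ C > 0, ∃ δ > 0, ∀ x, ‖x - x₀‖ ≤ δ → ∀ t ∈ Icc (0 : ℝ) 1,
      ‖X x t - X x₀ t‖ ≤ C * ‖x - x₀‖ := by
  obtain ⟨M, hM⟩ := hX.exists_bound x₀
  obtain ⟨K, hK⟩ := hv.exists_lipschitzOnWith (D := D) (M + 1)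
  -- This radius keeps the barrier below at most `1`, so a trajectory touching it still lies in the
  -- ball of radius `M + 1` where `K` is valid.
  refine ⟨Real.exp (K + 1), Real.exp_pos _, Real.exp (-(K + 1)), Real.exp_pos _,
    fun x hx t ht => ?_⟩
  rcases eq_or_ne x x₀ with rfl | hne
  · simp
  have hr : 0 < ‖x - x₀‖ := norm_pos_iff.2 (sub_ne_zero.2 hne)
  have hle1 : ∀ s ≤ (1 : ℝ), ‖x - x₀‖ * Real.exp ((K + 1) * s) ≤
      ‖x - x₀‖ * Real.exp (K + 1) := fun s hs => by
    gcongr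
    exact mul_le_of_le_one_right (by positivity) hs
  have h1 : ‖x - x₀‖ * Real.exp (K + 1) ≤ 1 := by
    calc ‖x - x₀‖ * Real.exp (K + 1) ≤ Real.exp (-(K + 1)) * Real.exp (K + 1) := by gcongr
      _ = 1 := by rw [← Real.exp_add]; simp
  -- The derivative is compared only at times when the norm equals the barrier, so no prior
  -- confinement of `X x` is needed. The rate `K + 1` and `x ≠ x₀` make the inequality strict.
  have key := image_norm_le_of_norm_deriv_right_lt_deriv_boundary
    (f := fun s => X x s - X x₀ s) (f' := fun s => v (X x s) s - v (X x₀ s) s)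
    (a := 0) (b := 1) (B := fun s => ‖x - x₀‖ * Real.exp ((K + 1) * s))
    (B' := fun s => (K + 1) * (‖x - x₀‖ * Real.exp ((K + 1) * s)))
    ((hX.continuousOn x).sub (hX.continuousOn x₀))
    (fun s hs => ((hX.deriv x s (Ico_subset_Icc_self hs)).sub
      (hX.deriv x₀ s (Ico_subset_Icc_self hs))).Ici_of_Icc hs)
    (by simp [hX.initial])
    (fun s => by
      refine (((hasDerivAt_id s).const_mul ((K : ℝ) + 1)).exp.const_mul ‖x - x₀‖).congr_deriv ?_
      simp only [id]
      ring)
    (fun s hs heq => ?_) ht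
  · refine key.trans ((hle1 t ht.2).trans_eq (mul_comm _ _))
  · have hs' := Ico_subset_Icc_self hs
    have hB : 0 < ‖x - x₀‖ * Real.exp ((K + 1) * s) := by positivity
    have hd1 : ‖X x s - X x₀ s‖ ≤ 1 := heq.trans_le ((hle1 s hs'.2).trans h1)
    have hx₀ : X x₀ s ∈ Metric.closedBall (0 : Space D) (M + 1) := by
      rw [mem_closedBall_zero_iff]; linarith [hM s hs']
    have hx' : X x s ∈ Metric.closedBall (0 : Space D) (M + 1) := by
      rw [mem_closedBall_zero_iff]
      have := norm_le_norm_add_norm_sub' (X x s) (X x₀ s)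
      linarith [hM s hs']
    have := (hK s hs').2.norm_sub_le hx' hx₀
    rw [heq] at this
    linarith

/-- The trajectories depend differentiably on the initial point, and the derivative solves the
linearized equation. -/
lemma IsTrajectoryFamily.exists_hasFDerivAt (hX : IsTrajectoryFamily v X)
    (hv : IsRegularVelocity v) (x₀ : Space D) :
    ∃ J : ℝ → Space D →L[ℝ] Space D, J 0 = ContinuousLinearMap.id ℝ (Space D) ∧
      (∀ t ∈ Icc (0 : ℝ) 1, HasDerivWithinAt J
        ((fderiv ℝ (fun y => v y t) (X x₀ t)).comp (J t)) (Icc 0 1) t) ∧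
      ∀ t ∈ Icc (0 : ℝ) 1, HasFDerivAt (fun x => X x t) (J t) x₀ := by
  have hAc := hv.continuousOn_fderiv_along (hX.continuousOn x₀)
  obtain ⟨J, hJ0, hJ⟩ := exists_linear_ode_solution
    (A := fun t => ContinuousLinearMap.compL ℝ (Space D) (Space D) (Space D)
      (fderiv ℝ (fun y => v y t) (X x₀ t)))
    ((ContinuousLinearMap.compL ℝ (Space D) (Space D) (Space D)).continuous.comp_continuousOn hAc)
    (ContinuousLinearMap.id ℝ (Space D))
  refine ⟨J, hJ0, hJ, fun t ht => ?_⟩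
  obtain ⟨C, hC, δ, hδ, hdist⟩ := hX.exists_dist_le hv x₀
  obtain ⟨M, hM⟩ := hX.exists_bound x₀
  obtain ⟨K, hK⟩ := hv.exists_lipschitzOnWith (D := D) (M + 1)
  rw [hasFDerivAt_iff_isLittleO, Asymptotics.isLittleO_iff]
  intro ε' hε'
  -- When the error `e` touches its barrier, `K` bounds the linearized term, `C` the Taylor
  -- remainder, and `1` gives strictness. The factor `exp (-L)` in `ε` absorbs the growth up to time
  -- `1`.
  set L : ℝ := K + C + 1 with hL
  have hL0 : 0 < L := by positivity
  set ε : ℝ := ε' * Real.exp (-L) with hε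
  have hε0 : 0 < ε := by positivity
  obtain ⟨η, hη, happ⟩ := hv.exists_uniform_approx (D := D) (M + 1) hε0
  -- The three radii give the stability estimate, the uniform linear approximation, and confinement
  -- to the ball of radius `M + 1`.
  have hnhds : Metric.closedBall x₀ (min δ (min (η / C) (1 / C))) ∈ nhds x₀ :=
    Metric.closedBall_mem_nhds _ (by positivity)
  filter_upwards [hnhds] with x hx
  rw [mem_closedBall_iff_norm, le_min_iff, le_min_iff, le_div_iff₀ hC, le_div_iff₀ hC] at hx
  obtain ⟨hxδ, hxη, hx1⟩ := hx
  rcases eq_or_ne x x₀ with rfl | hne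
  · simp
  have hr : 0 < ‖x - x₀‖ := norm_pos_iff.2 (sub_ne_zero.2 hne)
  have hJe : ∀ s ∈ Icc (0 : ℝ) 1, HasDerivWithinAt (fun s => J s (x - x₀))
      (fderiv ℝ (fun y => v y s) (X x₀ s) (J s (x - x₀))) (Icc 0 1) s := fun s hs =>
    ((hJ s hs).clm_apply (hasDerivWithinAt_const s _ (x - x₀))).congr_deriv (by simp)
  have hed : ∀ s ∈ Icc (0 : ℝ) 1, HasDerivWithinAt (fun s => X x s - X x₀ s - J s (x - x₀))
      (v (X x s) s - v (X x₀ s) s - fderiv ℝ (fun y => v y s) (X x₀ s) (J s (x - x₀)))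
      (Icc 0 1) s := fun s hs =>
    ((hX.deriv x s hs).sub (hX.deriv x₀ s hs)).sub (hJe s hs)
  have key := image_norm_le_of_norm_deriv_right_lt_deriv_boundary
    (f := fun s => X x s - X x₀ s - J s (x - x₀))
    (f' := fun s => v (X x s) s - v (X x₀ s) s -
      fderiv ℝ (fun y => v y s) (X x₀ s) (J s (x - x₀)))
    (a := 0) (b := 1) (B := fun s => ε * ‖x - x₀‖ * Real.exp (L * s))
    (B' := fun s => L * (ε * ‖x - x₀‖ * Real.exp (L * s)))
    (fun s hs => (hed s hs).continuousWithinAt)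
    (fun s hs => (hed s (Ico_subset_Icc_self hs)).Ici_of_Icc hs)
    (by simp [hX.initial, hJ0]; positivity)
    (fun s => by
      refine (((hasDerivAt_id s).const_mul L).exp.const_mul (ε * ‖x - x₀‖)).congr_deriv ?_
      simp only [id]
      ring)
    (fun s hs heq => ?_) ht
  · refine key.trans ?_
    have h1 : Real.exp (L * t) ≤ Real.exp L :=
      Real.exp_le_exp.2 (mul_le_of_le_one_right hL0.le ht.2)
    calc ε * ‖x - x₀‖ * Real.exp (L * t) ≤ ε * ‖x - x₀‖ * Real.exp L := by gcongr
      _ = ε' * ‖x - x₀‖ * (Real.exp (-L) * Real.exp L) := by rw [hε]; ring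
      _ = ε' * ‖x - x₀‖ := by rw [← Real.exp_add]; simp
  · have hs' := Ico_subset_Icc_self hs
    set e := X x s - X x₀ s - J s (x - x₀) with he
    have hd := hdist x hxδ s hs'
    have hx₀ : X x₀ s ∈ Metric.closedBall (0 : Space D) (M + 1) := by
      rw [mem_closedBall_zero_iff]; linarith [hM s hs']
    have hx' : X x s ∈ Metric.closedBall (0 : Space D) (M + 1) := by
      rw [mem_closedBall_zero_iff]
      have := norm_le_norm_add_norm_sub' (X x s) (X x₀ s)
      linarith [hM s hs']
    have h1 := happ s hs' _ hx' _ hx₀ (by rw [dist_eq_norm]; linarith)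
    have h2 : ‖fderiv ℝ (fun y => v y s) (X x₀ s) e‖ ≤ K * ‖e‖ :=
      ContinuousLinearMap.le_of_opNorm_le _ ((hK s hs').1 _ hx₀) _
    have h3 : v (X x s) s - v (X x₀ s) s - fderiv ℝ (fun y => v y s) (X x₀ s) (J s (x - x₀)) =
        (v (X x s) s - v (X x₀ s) s -
          fderiv ℝ (fun y => v y s) (X x₀ s) (X x s - X x₀ s)) +
        fderiv ℝ (fun y => v y s) (X x₀ s) e := by
      rw [he, map_sub _ (X x s - X x₀ s)]
      abel
    have hexp : 1 ≤ Real.exp (L * s) := Real.one_le_exp (mul_nonneg hL0.le hs.1)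
    have h4 : ε * ‖X x s - X x₀ s‖ ≤ C * (ε * ‖x - x₀‖ * Real.exp (L * s)) := by
      calc ε * ‖X x s - X x₀ s‖ ≤ ε * (C * ‖x - x₀‖) := by gcongr
        _ = C * (ε * ‖x - x₀‖ * 1) := by ring
        _ ≤ C * (ε * ‖x - x₀‖ * Real.exp (L * s)) := by gcongr
    have hB : 0 < ε * ‖x - x₀‖ * Real.exp (L * s) := by positivity
    rw [h3]
    refine (norm_add_le _ _).trans_lt ?_
    rw [heq] at h2
    calc _ ≤ C * (ε * ‖x - x₀‖ * Real.exp (L * s)) + K * (ε * ‖x - x₀‖ * Real.exp (L * s)) :=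
          add_le_add (h1.trans h4) h2
      _ < L * (ε * ‖x - x₀‖ * Real.exp (L * s)) := by rw [hL]; linarith

/-- Trajectories do not merge. -/
lemma IsTrajectoryFamily.injective (hX : IsTrajectoryFamily v X) (hv : IsRegularVelocity v)
    {t : ℝ} (ht : t ∈ Icc (0 : ℝ) 1) : Function.Injective fun x => X x t := by
  intro x y hxy
  obtain ⟨M₁, hM₁⟩ := hX.exists_bound x
  obtain ⟨M₂, hM₂⟩ := hX.exists_bound y
  obtain ⟨K, hK⟩ := hv.exists_lipschitzOnWith (D := D) (max M₁ M₂)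
  have hsub : Icc 0 t ⊆ Icc (0 : ℝ) 1 := Icc_subset_Icc_right ht.2
  have hderiv : ∀ z, ∀ s ∈ Ioc 0 t, HasDerivWithinAt (X z) (v (X z s) s) (Iic s) s := by
    intro z s hs
    exact (hX.deriv z s (hsub (Ioc_subset_Icc_self hs))).mono_of_mem_nhdsWithin
      (Icc_mem_nhdsLE_of_mem ⟨hs.1, hs.2.trans ht.2⟩)
  -- Uniqueness is run backwards from the common value at time `t`, in a ball containing both
  -- trajectories.
  have h := ODE_solution_unique_of_mem_Icc_left (v := fun s y => v y s)
    (s := fun _ => Metric.closedBall (0 : Space D) (max M₁ M₂)) (K := K)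
    (fun s hs => (hK s (hsub (Ioc_subset_Icc_self hs))).2)
    ((hX.continuousOn x).mono hsub) (hderiv x)
    (fun s hs => mem_closedBall_zero_iff.2
      ((hM₁ s (hsub (Ioc_subset_Icc_self hs))).trans (le_max_left _ _)))
    ((hX.continuousOn y).mono hsub) (hderiv y)
    (fun s hs => mem_closedBall_zero_iff.2
      ((hM₂ s (hsub (Ioc_subset_Icc_self hs))).trans (le_max_right _ _))) hxy
  have h0 := h (left_mem_Icc.2 ht.1)
  rwa [hX.initial, hX.initial] at h0

end Flow

/-! ### Jacobi's formula for a matrix solution of a linear equation. -/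

section Determinant

/-- Differentiating the determinant row by row replaces row `i` by `∑ k, A i k • M k`. Every term
with `k ≠ i` repeats a row, so only `A i i * det M` survives, and these add up to the trace. -/
lemma hasDerivWithinAt_det {n : Type*} [Fintype n] [DecidableEq n] {M A : ℝ → Matrix n n ℝ}
    {s : Set ℝ} {t : ℝ}
    (hM : ∀ i, HasDerivWithinAt (fun u => M u i) ((A t * M t) i) s t) :
    HasDerivWithinAt (fun u => (M u).det) ((A t).trace * (M t).det) s t := by
  let d : ContinuousMultilinearMap ℝ (fun _ : n => n → ℝ) ℝ :=
    ⟨(Matrix.detRowAlternating (n := n) (R := ℝ)).toMultilinearMap,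
      Continuous.matrix_det continuous_id⟩
  have h1 : HasDerivWithinAt (fun u => (M u : n → n → ℝ)) ((A t * M t : Matrix n n ℝ)) s t :=
    hasDerivWithinAt_pi.2 hM
  have h2 : HasFDerivAt d (d.linearDeriv (M t)) (M t) := d.hasFDerivAt (M t)
  refine (h2.comp_hasDerivWithinAt t h1).congr_deriv ?_
  refine (ContinuousMultilinearMap.linearDeriv_apply d _ _).trans ?_
  rw [Matrix.trace, Finset.sum_mul]
  refine Finset.sum_congr rfl fun i _ => ?_
  have h3 : (A t * M t) i = ∑ k, A t i k • M t k := by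
    ext j
    simp [Matrix.mul_apply, Finset.sum_apply]
  have h4 := Matrix.det_updateRow_sum (M t) i (A t i)
  rw [smul_eq_mul] at h4
  rw [Matrix.diag_apply, ← h4, ← h3]
  rfl

end Determinant

/-! ### The Jacobian determinant of the flow. -/

section Flow

variable {D : ℕ} {v : Space D → ℝ → Space D} {X : Space D → ℝ → Space D}

/-- Liouville's formula for the Jacobian determinant of the flow. -/
lemma IsTrajectoryFamily.exists_hasFDerivAt_det (hX : IsTrajectoryFamily v X)
    (hv : IsRegularVelocity v) (x₀ : Space D) {t : ℝ} (ht : t ∈ Icc (0 : ℝ) 1) :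
    ∃ J : Space D →L[ℝ] Space D, HasFDerivAt (fun x => X x t) J x₀ ∧
      J.det = Real.exp (∫ s in (0 : ℝ)..t, divergence (fun y => v y s) (X x₀ s)) := by
  obtain ⟨J, hJ0, hJ, hd⟩ := hX.exists_hasFDerivAt hv x₀
  refine ⟨J t, hd t ht, ?_⟩
  let b := (EuclideanSpace.basisFun (Fin D) ℝ).toBasis
  let m : (Space D →L[ℝ] Space D) → Matrix (Fin D) (Fin D) ℝ := fun f =>
    LinearMap.toMatrix b b (f : Space D →ₗ[ℝ] Space D)
  have hm : ∀ f i j, m f i j = (f (EuclideanSpace.single j 1)) i := by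
    intro f i j
    simp [m, b, LinearMap.toMatrix_apply]
  have hdet : ∀ f : Space D →L[ℝ] Space D, f.det = (m f).det := fun f =>
    (LinearMap.det_toMatrix b (f : Space D →ₗ[ℝ] Space D)).symm
  have hmul : ∀ f g : Space D →L[ℝ] Space D, m (f.comp g) = m f * m g := fun f g =>
    LinearMap.toMatrix_comp b b b _ _
  have hode : ∀ s ∈ Icc (0 : ℝ) 1, HasDerivWithinAt (fun s => (J s).det)
      (divergence (fun y => v y s) (X x₀ s) * (J s).det) (Icc 0 1) s := by
    intro s hs
    have h := hasDerivWithinAt_det (M := fun s => m (J s))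
      (A := fun s => m (fderiv ℝ (fun y => v y s) (X x₀ s))) (s := Icc 0 1) (t := s) fun i => ?_
    · simp only [← hdet] at h
      convert h using 2
      simp [divergence, Matrix.trace, hm]
    · refine hasDerivWithinAt_pi.2 fun j => ?_
      rw [← hmul]
      simp only [hm]
      have h1 := (hJ s hs).clm_apply
        (hasDerivWithinAt_const s (Icc 0 1) (EuclideanSpace.single j (1 : ℝ)))
      have h2 := (EuclideanSpace.proj (𝕜 := ℝ) i : Space D →L[ℝ] ℝ).hasFDerivAt
        |>.comp_hasDerivWithinAt s h1
      simpa [Function.comp_def] using h2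
  have h := eq_mul_exp_integral (hv.continuousOn_divergence_along (hX.continuousOn x₀)) hode ht
  have hone : (ContinuousLinearMap.id ℝ (Space D)).det = 1 := LinearMap.det_id
  rw [h, hJ0, hone, one_mul]

end Flow

/-! ### Transport of mass and reweighting. -/

section ChangeOfVariables

variable {D : ℕ} {mu : Space D → ℝ} {rhoU : Space D → ℝ → ℝ} {v : Space D → ℝ → Space D}
  {X : Space D → ℝ → Space D} {rhoTheta : Space D → ℝ → ℝ}
  (hrhoU : IsUnnormalizedPath rhoU) (hmu : ∀ x, targetDensity rhoU x 0 = mu x)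
  (hv : IsRegularVelocity v) (hX : IsTrajectoryFamily v X)
  (hrho : IsLiouvilleDensity v mu rhoTheta)

include hv hX hrho in
/-- The flow has a derivative whose determinant is the ratio of the densities. -/
lemma exists_hasFDerivAt_density {t : ℝ} (ht : t ∈ Icc (0 : ℝ) 1) :
    ∃ J : Space D → Space D →L[ℝ] Space D, ∀ x, HasFDerivAt (fun x => X x t) (J x) x ∧
      |(J x).det| * rhoTheta (X x t) t = mu x := by
  choose J hJ hdet using fun x => hX.exists_hasFDerivAt_det hv x ht
  refine ⟨J, fun x => ⟨hJ x, ?_⟩⟩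
  rw [hdet, abs_of_pos (Real.exp_pos _), hrho.eq_mul_exp hv hX x ht, mul_left_comm,
    ← Real.exp_add]
  simp

include hv hX hrho in
/-- No mass of `ρ_θ` lies outside the image of the flow. -/
lemma densityMeasure_compl_range {t : ℝ} (ht : t ∈ Icc (0 : ℝ) 1) :
    densityMeasure (fun x => rhoTheta x t) (range fun x => X x t)ᶜ = 0 := by
  obtain ⟨J, hJ⟩ := exists_hasFDerivAt_density hv hX hrho ht
  have hmeas : MeasurableSet (range fun x => X x t) := by
    rw [← image_univ]
    exact measurable_image_of_fderivWithin MeasurableSet.univ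
      (fun x _ => (hJ x).1.hasFDerivWithinAt) (hX.injective hv ht).injOn
  have hd := hrho.density t ht
  have hd0 := hrho.density 0 ⟨le_rfl, zero_le_one⟩
  -- The `ρ_θ`-mass of the image is the full mass of `μ`, so nothing is left for the complement.
  have h1 : ∫⁻ x in range (fun x => X x t), ENNReal.ofReal (rhoTheta x t) =
      ∫⁻ x, ENNReal.ofReal (mu x) := by
    rw [← image_univ, lintegral_image_eq_lintegral_abs_det_fderiv_mul volume MeasurableSet.univ
      (fun x _ => (hJ x).1.hasFDerivWithinAt) (hX.injective hv ht).injOn, Measure.restrict_univ]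
    refine lintegral_congr fun x => ?_
    rw [← ENNReal.ofReal_mul (abs_nonneg _), (hJ x).2]
  have hone : ∀ p : Space D → ℝ, IsProbabilityDensity p → ∫⁻ x, ENNReal.ofReal (p x) = 1 := by
    intro p hp
    rw [← ofReal_integral_eq_lintegral_ofReal hp.integrable (ae_of_all _ hp.nonneg),
      hp.integral_eq_one, ENNReal.ofReal_one]
  have hmu1 : ∫⁻ x, ENNReal.ofReal (mu x) = 1 := by
    simpa only [hrho.initial] using hone _ hd0
  rw [densityMeasure, withDensity_apply _ hmeas.compl]
  have hsum := lintegral_add_compl (μ := volume) (fun x => ENNReal.ofReal (rhoTheta x t)) hmeas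
  rw [h1, hmu1, hone _ hd] at hsum
  exact (ENNReal.add_right_inj ENNReal.one_ne_top).1 (hsum.trans (add_zero 1).symm)

include hrhoU hmu hv hX hrho in
/-- Importance reweighting along the trajectories reproduces the target expectations. -/
lemma reweighting {t : ℝ} (ht : t ∈ Icc (0 : ℝ) 1)
    (hac : densityMeasure (fun x => targetDensity rhoU x t) ≪
      densityMeasure (fun x => rhoTheta x t)) (F : Space D → ℝ) :
    (Integrable F (densityMeasure (fun x => targetDensity rhoU x t)) ↔
      Integrable (fun x₀ => pathWeight v rhoU X t x₀ * F (X x₀ t)) (densityMeasure mu)) ∧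
    ∫ x, F x ∂(densityMeasure (fun x => targetDensity rhoU x t)) =
      ∫ x₀, pathWeight v rhoU X t x₀ * F (X x₀ t) ∂(densityMeasure mu) := by
  obtain ⟨J, hJ⟩ := exists_hasFDerivAt_density hv hX hrho ht
  have hJ' : ∀ x ∈ univ, HasFDerivWithinAt (fun x => X x t) (J x) univ x :=
    fun x _ => (hJ x).1.hasFDerivWithinAt
  have hinj : InjOn (fun x => X x t) univ := (hX.injective hv ht).injOn
  have hcont := hrhoU.continuous_targetDensity ht
  have hpos : ∀ x, 0 < targetDensity rhoU x t := fun x => hrhoU.targetDensity_pos x ht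
  have hmu_meas : Measurable mu := by
    rw [← funext hmu]
    exact (hrhoU.continuous_targetDensity ⟨le_rfl, zero_le_one⟩).measurable
  have hmu0 : ∀ x, 0 ≤ mu x := fun x => (hrhoU.initial_pos hmu x).le
  have hmeas : MeasurableSet ((fun x => X x t) '' univ) :=
    measurable_image_of_fderivWithin MeasurableSet.univ hJ' hinj
  -- Domination carries the null set over to `ρ_*`, and positivity of `ρ_*` carries it over to
  -- Lebesgue measure.
  have hnull : volume ((fun x => X x t) '' univ)ᶜ = 0 := by
    have h1 := hac (densityMeasure_compl_range hv hX hrho ht)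
    rw [← image_univ, densityMeasure,
      withDensity_apply_eq_zero hcont.measurable.ennreal_ofReal] at h1
    simpa [hpos, Set.ofPred_true] using h1
  have hrestrict : volume.restrict ((fun x => X x t) '' univ) = (volume : Measure (Space D)) :=
    Measure.restrict_eq_self_of_ae_mem (mem_ae_iff.2 hnull)
  -- The Jacobian turns `ρ_θ` into `μ`, which leaves the ratio `ρ_*/ρ_θ`, the path weight.
  have hpt : ∀ x, |(J x).det| • (targetDensity rhoU (X x t) t * F (X x t)) =
      mu x * (pathWeight v rhoU X t x * F (X x t)) := by
    intro x
    have hθ := (hrho.pos_along hrhoU hmu hv hX x ht).ne'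
    rw [← targetDensity_div_eq_pathWeight hrhoU hmu hv hX hrho x ht, ← (hJ x).2, smul_eq_mul]
    field_simp
  rw [integrable_densityMeasure_iff hcont.measurable fun x => (hpos x).le,
    integrable_densityMeasure_iff hmu_meas hmu0,
    integral_densityMeasure hcont.measurable fun x => (hpos x).le,
    integral_densityMeasure hmu_meas hmu0]
  have hI := integrableOn_image_iff_integrableOn_abs_det_fderiv_smul volume MeasurableSet.univ
    hJ' hinj (fun x => targetDensity rhoU x t * F x)
  have hE := integral_image_eq_integral_abs_det_fderiv_smul volume MeasurableSet.univ
    hJ' hinj (fun x => targetDensity rhoU x t * F x)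
  simp only [IntegrableOn, hrestrict, Measure.restrict_univ, hpt] at hI hE
  exact ⟨hI, hE⟩

end ChangeOfVariables

/-- The equality of expectations stands outside the integrability condition: by the equivalence,
when one side is not integrable neither is the other, and both Bochner integrals are `0`. -/
theorem mainTheorem4 {D : ℕ}
    (mu : Space D → ℝ)
    (rhoU : Space D → ℝ → ℝ) (hrhoU : IsUnnormalizedPath rhoU)
    (hmu : ∀ x, targetDensity rhoU x 0 = mu x)
    (v : Space D → ℝ → Space D) (hv : IsRegularVelocity v)
    (X : Space D → ℝ → Space D) (hX : IsTrajectoryFamily v X)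
    (rhoTheta : Space D → ℝ → ℝ) (hrhoTheta : IsLiouvilleDensity v mu rhoTheta) :
    (∀ x₀ : Space D,
      IntervalIntegrable (fun s => velocityResidual v rhoU (X x₀ s) s) volume 0 1 ∧
      ∀ t ∈ Icc (0 : ℝ) 1,
        0 < targetDensity rhoU (X x₀ t) t ∧
        0 < rhoTheta (X x₀ t) t ∧
        Real.log (targetDensity rhoU (X x₀ t) t / rhoTheta (X x₀ t) t)
          = ∫ s in (0 : ℝ)..t, velocityResidual v rhoU (X x₀ s) s ∧
        targetDensity rhoU (X x₀ t) t / rhoTheta (X x₀ t) t = pathWeight v rhoU X t x₀) ∧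
    (∀ t ∈ Icc (0 : ℝ) 1,
      densityMeasure (fun x => targetDensity rhoU x t)
          ≪ densityMeasure (fun x => rhoTheta x t) →
      ∀ F : Space D → ℝ,
        AEStronglyMeasurable F (densityMeasure (fun x => targetDensity rhoU x t)) →
        (Integrable F (densityMeasure (fun x => targetDensity rhoU x t)) ↔
          Integrable (fun x₀ => pathWeight v rhoU X t x₀ * F (X x₀ t)) (densityMeasure mu)) ∧
        ∫ x, F x ∂(densityMeasure (fun x => targetDensity rhoU x t))
          = ∫ x₀, pathWeight v rhoU X t x₀ * F (X x₀ t) ∂(densityMeasure mu)) :=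
  ⟨fun x₀ => ⟨(integral_velocityResidual hrhoU hv hX x₀).1, fun _ ht =>
    ⟨hrhoU.targetDensity_pos _ ht, hrhoTheta.pos_along hrhoU hmu hv hX x₀ ht,
      log_targetDensity_div hrhoU hmu hv hX hrhoTheta x₀ ht,
      targetDensity_div_eq_pathWeight hrhoU hmu hv hX hrhoTheta x₀ ht⟩⟩,
    fun _ ht hac F _ => reweighting hrhoU hmu hv hX hrhoTheta ht hac F⟩
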